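/- For $n\ge 1$ let $$y_n(z)=\sum_{k=0}^{n}\frac{(n+k)!}{(n-k)!\,k!}\left(\frac z2\right)^k$$ be the $n$-th Bessel polynomial, let $\alpha_{n1},\dots,\alpha_{nn}\in\mathbb{C}$ be its zeros, listed with multiplicity, and put $a_{nk}=1-\alpha_{nk}/2$ and $b_{nk}=1+\alpha_{nk}/2$ for $k=1,\dots,n$. Then, for every $n\ge1$ and every $k=1,\dots,n$, $$|a_{nk}|>1\qquad\text{and}\qquad |b_{nk}|<1.$$ -/

import Mathlib

open Polynomial Nat

/-- The `n`-th Bessel polynomial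
`y_n(z) = ∑_{k=0}^n (n+k)! / ((n-k)! k!) * (z/2)^k`, over `ℂ`. -/
noncomputable def besselPolynomial (n : ℕ) : ℂ[X] :=
  ∑ k ∈ Finset.range (n + 1),
    C (((n + k)! : ℂ) / (((n - k)! : ℂ) * (k ! : ℂ))) * (C (1 / 2) * X) ^ k

/-- `α 0, …, α (n-1)` lists all complex zeros of the `n`-th Bessel polynomial,
each as often as its multiplicity. -/
def IsBesselZeros (n : ℕ) (α : Fin n → ℂ) : Prop :=
  Finset.univ.val.map α = (besselPolynomial n).roots

/-- The node `1 - α / 2` attached to a zero `α`. -/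
noncomputable def nodeA (α : ℂ) : ℂ := 1 - α / 2

/-- The node `1 + α / 2` attached to a zero `α`. -/
noncomputable def nodeB (α : ℂ) : ℂ := 1 + α / 2

/-! ### Energy identities for `f'' = Q f` -/

section LinearODE

variable {f g Q : ℝ → ℂ}

/-! Both inequalities follow from `Re (1/α) < -1/4`: the second is equivalent to it, the first needs
only `Re α < 0`.

Put `w = 1/z`. The function `e^{-w} y_n(1/w)` solves `f'' = (1 + n(n+1)/w²) f` and decays along each
horizontal line `w = u + iv`. For `v ≠ 0`, `G = v Im(f' conj f)` decreases to `0` on `u ≥ 0`. A zero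
at `a ≥ 0` makes `G`, hence `f`, vanish to its right, contradicting `y_n(0) = 1`. If `-1/4 ≤ a < 0`,
the same works once `G(|a|) ≤ G(a) = 0`, which holds because `|f|` increases on `[a, |a|]`
(`monotoneOn_normSq_of_neg_three_le`). That requires `Re Q ≥ -3`, supplied by `|z| ≤ 2/(n+1)`
(`norm_le_of_isRoot_besselPolynomial`). Real zeros are handled by positivity of the coefficients and
the same bound. -/

theorem hasDerivAt_mul_conj (hf : ∀ u, HasDerivAt f (g u) u)
    (hg : ∀ u, HasDerivAt g (Q u * f u) u) (u : ℝ) :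
    HasDerivAt (fun u => g u * (starRingEnd ℂ) (f u))
      (Q u * (Complex.normSq (f u) : ℂ) + (Complex.normSq (g u) : ℂ)) u := by
  have h := (hg u).mul (hf u).star
  refine h.congr_deriv ?_
  simp only [Complex.star_def, mul_assoc, Complex.mul_conj]

theorem hasDerivAt_im_mul_conj (hf : ∀ u, HasDerivAt f (g u) u)
    (hg : ∀ u, HasDerivAt g (Q u * f u) u) (u : ℝ) :
    HasDerivAt (fun u => (g u * (starRingEnd ℂ) (f u)).im)
      ((Q u).im * Complex.normSq (f u)) u := by
  have h := Complex.imCLM.hasFDerivAt.comp_hasDerivAt u (hasDerivAt_mul_conj hf hg u)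
  exact h.congr_deriv (by simp)

theorem hasDerivAt_re_mul_conj (hf : ∀ u, HasDerivAt f (g u) u)
    (hg : ∀ u, HasDerivAt g (Q u * f u) u) (u : ℝ) :
    HasDerivAt (fun u => (g u * (starRingEnd ℂ) (f u)).re)
      ((Q u).re * Complex.normSq (f u) + Complex.normSq (g u)) u := by
  have h := Complex.reCLM.hasFDerivAt.comp_hasDerivAt u (hasDerivAt_mul_conj hf hg u)
  exact h.congr_deriv (by simp)

theorem hasDerivAt_normSq (hf : ∀ u, HasDerivAt f (g u) u) (u : ℝ) :
    HasDerivAt (fun u => Complex.normSq (f u)) (2 * (g u * (starRingEnd ℂ) (f u)).re) u := by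
  have h := Complex.reCLM.hasFDerivAt.comp_hasDerivAt u ((hf u).mul (hf u).star)
  have e : (fun u => Complex.normSq (f u)) = Complex.reCLM ∘ (f * fun u => star (f u)) := by
    ext u
    simp [Complex.normSq_apply]
  rw [e]
  refine h.congr_deriv ?_
  simp
  ring

/-- A solution of `f'' = Q f` with `f a = 0` and `Re Q ≥ -3` has nondecreasing modulus on
`[a, a + 1/2]`. -/
theorem monotoneOn_normSq_of_neg_three_le (hf : ∀ u, HasDerivAt f (g u) u)
    (hg : ∀ u, HasDerivAt g (Q u * f u) u) {a b : ℝ} (hb : b ≤ a + 1 / 2) (ha : f a = 0)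
    (hQ : ∀ u ∈ Set.Icc a b, -3 ≤ (Q u).re) :
    MonotoneOn (fun u => Complex.normSq (f u)) (Set.Icc a b) := by
  -- Riccati comparison: with `s = u - a + 3/10`, `r' + r² = -9/2 + 9s²/4`. Both `r' + r² ≤ -3` and
  -- `r ≥ 0` hold while `s² ≤ 2/3`; here `3/10 ≤ s ≤ 4/5`.
  set r : ℝ → ℝ := fun u => (u - a + 3 / 10)⁻¹ - 3 / 2 * (u - a + 3 / 10) with hr
  have hrd : ∀ u ∈ Set.Icc a b, HasDerivAt r (-1 / (u - a + 3 / 10) ^ 2 - 3 / 2) u := by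
    intro u hu
    have h0 : u - a + 3 / 10 ≠ 0 := by linarith [hu.1]
    have h1 : HasDerivAt (fun u : ℝ => u - a + 3 / 10) 1 u :=
      ((hasDerivAt_id u).sub_const a).add_const _
    exact ((h1.inv h0).sub (h1.const_mul (3 / 2))).congr_deriv (by ring)
  set E : ℝ → ℝ := fun u => (g u * (starRingEnd ℂ) (f u)).re - r u * Complex.normSq (f u) with hE
  have hEd : ∀ u ∈ Set.Icc a b, HasDerivAt E ((Q u).re * Complex.normSq (f u) +
      Complex.normSq (g u) - ((-1 / (u - a + 3 / 10) ^ 2 - 3 / 2) * Complex.normSq (f u) +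
      r u * (2 * (g u * (starRingEnd ℂ) (f u)).re))) u := fun u hu =>
    (hasDerivAt_re_mul_conj hf hg u).sub ((hrd u hu).mul (hasDerivAt_normSq hf u))
  have hEmono : MonotoneOn E (Set.Icc a b) := by
    refine monotoneOn_of_hasDerivWithinAt_nonneg (convex_Icc a b)
      (fun u hu => (hEd u hu).continuousAt.continuousWithinAt)
      (fun u hu => (hEd u (interior_subset hu)).hasDerivWithinAt) fun u hu => ?_
    replace hu := interior_subset hu
    have hs : 0 < u - a + 3 / 10 := by linarith [hu.1]
    have hs' : u - a + 3 / 10 ≤ 8 / 10 := by linarith [hu.2]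
    have hq := hQ u hu
    have hsq : 0 ≤ Complex.normSq (g u - r u * f u) := Complex.normSq_nonneg _
    have hexp : Complex.normSq (g u - r u * f u) = Complex.normSq (g u) +
        r u ^ 2 * Complex.normSq (f u) - r u * (2 * (g u * (starRingEnd ℂ) (f u)).re) := by
      simp [Complex.normSq_apply]
      ring
    have hcoef : 0 ≤ (Q u).re - (-1 / (u - a + 3 / 10) ^ 2 - 3 / 2) - r u ^ 2 := by
      have : r u ^ 2 = 1 / (u - a + 3 / 10) ^ 2 - 3 + 9 / 4 * (u - a + 3 / 10) ^ 2 := by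
        simp only [hr]
        generalize u - a + 3 / 10 = s at hs
        field_simp
        ring
      rw [this, neg_div]
      nlinarith
    have := mul_nonneg hcoef (Complex.normSq_nonneg (f u))
    nlinarith
  refine monotoneOn_of_hasDerivWithinAt_nonneg (convex_Icc a b)
    (fun u _ => (hasDerivAt_normSq hf u).continuousAt.continuousWithinAt)
    (fun u _ => (hasDerivAt_normSq hf u).hasDerivWithinAt) fun u hu => ?_
  replace hu := interior_subset hu
  have h1 : E a ≤ E u := hEmono ⟨le_rfl, hu.1.trans hu.2⟩ hu hu.1
  have h2 : E a = 0 := by simp [hE, ha]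
  have hs : 0 < u - a + 3 / 10 := by linarith [hu.1]
  have hs' : u - a + 3 / 10 ≤ 8 / 10 := by linarith [hu.2]
  have h3 : 0 ≤ r u := by
    have : 10 / 8 ≤ (u - a + 3 / 10)⁻¹ := by
      rw [le_inv_comm₀ (by norm_num) hs]
      linarith
    simp only [hr]
    linarith
  have h4 := mul_nonneg h3 (Complex.normSq_nonneg (f u))
  simp only [hE] at h1 h2
  linarith

/-- A decaying solution of `f'' = Q f` cannot have a zero at `a ≥ -1/4` when `Im Q` is odd with a
constant sign on the positive axis, unless it vanishes to the right of `|a|`. -/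
theorem eq_zero_of_decaying_of_eq_zero (hf : ∀ u, HasDerivAt f (g u) u)
    (hg : ∀ u, HasDerivAt g (Q u * f u) u)
    (hlim : Filter.Tendsto (fun u => (g u * (starRingEnd ℂ) (f u)).im) Filter.atTop (nhds 0))
    {ε : ℝ} {q : ℝ → ℝ} (hq : ∀ u, ε * (Q u).im = -(u * q u)) (hqpos : ∀ u, 0 < q u)
    (hqeven : ∀ u, q (-u) = q u) {a : ℝ} (ha : -(1 / 4) ≤ a) (hfa : f a = 0)
    (hQ : a < 0 → ∀ u, -3 ≤ (Q u).re) {u : ℝ} (hu : |a| < u) : f u = 0 := by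
  set G : ℝ → ℝ := fun u => ε * (g u * (starRingEnd ℂ) (f u)).im with hG
  have hGd : ∀ u, HasDerivAt G (-(u * q u) * Complex.normSq (f u)) u := fun u =>
    ((hasDerivAt_im_mul_conj hf hg u).const_mul ε).congr_deriv (by rw [← hq u]; ring)
  have hGlim : Filter.Tendsto G Filter.atTop (nhds 0) := by
    simpa only [mul_zero] using hlim.const_mul ε
  have hGanti : AntitoneOn G (Set.Ici 0) := by
    refine antitoneOn_of_hasDerivWithinAt_nonpos (convex_Ici 0)
      (fun u _ => (hGd u).continuousAt.continuousWithinAt)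
      (fun u _ => (hGd u).hasDerivWithinAt) fun u hu => ?_
    have hu0 : 0 ≤ u := interior_subset hu
    have := mul_nonneg (mul_nonneg hu0 (hqpos u).le) (Complex.normSq_nonneg (f u))
    linarith
  have hGnonneg : ∀ u, 0 ≤ u → 0 ≤ G u := fun u hu =>
    le_of_tendsto hGlim (Filter.eventually_atTop.2 ⟨u, fun t ht => hGanti hu (hu.trans ht) ht⟩)
  have hGa : G a = 0 := by simp [hG, hfa]
  have hGabs : G |a| ≤ 0 := by
    rcases le_or_gt 0 a with h | h
    · rw [abs_of_nonneg h, hGa]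
    · rw [abs_of_neg h]
      have hmono := monotoneOn_normSq_of_neg_three_le hf hg (a := a) (b := -a) (by linarith) hfa
        (fun u _ => hQ h u)
      -- Since `q` is even, this derivative is `-s q(s) (|f(s)|² - |f(-s)|²)`, which is nonpositive
      -- by monotonicity of `|f|`.
      have hHd : ∀ s, HasDerivAt (fun s => G s - G (-s)) (-(s * q s) * Complex.normSq (f s) -
          (-(-s * q (-s)) * Complex.normSq (f (-s)) * -1)) s := fun s =>
        (hGd s).sub ((hGd (-s)).comp s (hasDerivAt_neg s))
      have hH : AntitoneOn (fun s => G s - G (-s)) (Set.Icc 0 (-a)) := by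
        refine antitoneOn_of_hasDerivWithinAt_nonpos (convex_Icc 0 (-a))
          (fun u _ => (hHd u).continuousAt.continuousWithinAt)
          (fun u _ => (hHd u).hasDerivWithinAt) fun s hs => ?_
        obtain ⟨h1, h2⟩ := interior_subset hs
        have h3 : Complex.normSq (f (-s)) ≤ Complex.normSq (f s) :=
          hmono ⟨by linarith, by linarith⟩ ⟨by linarith, h2⟩ (by linarith)
        have h4 := mul_nonneg (mul_nonneg h1 (hqpos s).le) (sub_nonneg.2 h3)
        rw [hqeven]
        linarith
      have := hH ⟨le_rfl, by linarith⟩ ⟨by linarith, le_rfl⟩ (by linarith : (0 : ℝ) ≤ -a)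
      simp only [neg_zero, sub_self, neg_neg, hGa, sub_zero] at this
      exact this
  have hGzero : ∀ t, |a| < t → G t = 0 := fun t ht =>
    le_antisymm ((hGanti (abs_nonneg a) ((abs_nonneg a).trans ht.le) ht.le).trans hGabs)
      (hGnonneg t ((abs_nonneg a).trans ht.le))
  have hd : HasDerivAt G 0 u := (hasDerivAt_const u (0 : ℝ)).congr_of_eventuallyEq
    (Filter.eventually_of_mem (Ioi_mem_nhds hu) fun t ht => hGzero t ht)
  have h0 := (hGd u).unique hd
  have hupos : 0 < u := (abs_nonneg a).trans_lt hu
  have hqu := (mul_pos hupos (hqpos u)).ne'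
  exact Complex.normSq_eq_zero.1 ((mul_eq_zero.1 h0).resolve_left (neg_ne_zero.2 hqu))

end LinearODE

/-! ### Bessel polynomials: coefficients, differential equation, simple zeros -/

theorem coeff_besselPolynomial (n k : ℕ) : (besselPolynomial n).coeff k =
    if k ≤ n then ((n + k)! : ℂ) / (((n - k)! : ℂ) * (k ! : ℂ)) * (1 / 2) ^ k else 0 := by
  simp only [besselPolynomial, finsetSum_coeff, mul_pow, ← C_pow, ← mul_assoc, ← C_mul,
    coeff_C_mul, coeff_X_pow, mul_ite, mul_one, mul_zero, Finset.sum_ite_eq, Finset.mem_range,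
    Nat.lt_succ_iff]

theorem coeff_besselPolynomial_succ (n k : ℕ) :
    2 * (k + 1 : ℂ) * (besselPolynomial n).coeff (k + 1) =
      (n - k : ℂ) * (n + k + 1) * (besselPolynomial n).coeff k := by
  simp only [coeff_besselPolynomial]
  rcases lt_trichotomy k n with h | h | h
  · obtain ⟨d, rfl⟩ := Nat.exists_eq_add_of_lt h
    have e1 : k + d + 1 - (k + 1) = d := by omega
    have e2 : k + d + 1 - k = d + 1 := by omega
    rw [if_pos (by omega), if_pos (by omega), e1, e2, ← add_assoc, Nat.factorial_succ (_ + k),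
      Nat.factorial_succ d, Nat.factorial_succ k]
    have hd : (d ! : ℂ) ≠ 0 := by exact_mod_cast d.factorial_ne_zero
    have hk : (k ! : ℂ) ≠ 0 := by exact_mod_cast k.factorial_ne_zero
    have hd' : (d + 1 : ℂ) ≠ 0 := by exact_mod_cast d.succ_ne_zero
    have hk' : (k + 1 : ℂ) ≠ 0 := by exact_mod_cast k.succ_ne_zero
    push_cast
    field_simp
    ring
  · subst h
    simp
  · rw [if_neg (by omega), if_neg (by omega)]
    simp

theorem besselPolynomial_ode (n : ℕ) :
    X ^ 2 * derivative (derivative (besselPolynomial n)) +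
      (2 * X + 2) * derivative (besselPolynomial n) =
      C ((n : ℂ) * (n + 1)) * besselPolynomial n := by
  ext k
  have h := coeff_besselPolynomial_succ n k
  rw [coeff_add, coeff_C_mul, add_mul, coeff_add, mul_assoc (2 : ℂ[X]),
    ← C_ofNat, coeff_C_mul, coeff_C_mul, mul_comm (X ^ 2) , coeff_mul_X_pow']
  rcases k with _ | _ | k
  · simp [coeff_derivative] at h ⊢
    linear_combination h
  · simp [coeff_derivative] at h ⊢
    linear_combination h
  · simp [coeff_derivative, coeff_X_mul] at h ⊢
    linear_combination h

theorem coeff_zero_besselPolynomial (n : ℕ) : (besselPolynomial n).coeff 0 = 1 := by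
  have : (n ! : ℂ) ≠ 0 := by exact_mod_cast n.factorial_ne_zero
  simp [coeff_besselPolynomial, this]

theorem eval_zero_besselPolynomial (n : ℕ) : (besselPolynomial n).eval 0 = 1 := by
  rw [← coeff_zero_eq_eval_zero, coeff_zero_besselPolynomial]

theorem besselPolynomial_ne_zero (n : ℕ) : besselPolynomial n ≠ 0 := by
  intro h
  have := eval_zero_besselPolynomial n
  simp [h] at this

theorem natDegree_besselPolynomial (n : ℕ) : (besselPolynomial n).natDegree = n := by
  refine natDegree_eq_of_le_of_coeff_ne_zero ?_ ?_
  · rw [natDegree_le_iff_coeff_eq_zero]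
    intro k hk
    rw [coeff_besselPolynomial, if_neg (by omega)]
  · rw [coeff_besselPolynomial, if_pos le_rfl]
    have h1 : ((n + n)! : ℂ) ≠ 0 := by exact_mod_cast (n + n).factorial_ne_zero
    have h2 : (n ! : ℂ) ≠ 0 := by exact_mod_cast n.factorial_ne_zero
    simp [h1, h2]

theorem eval_besselPolynomial_ofReal_ne_zero (n : ℕ) {x : ℝ} (hx : 0 ≤ x) :
    (besselPolynomial n).eval (x : ℂ) ≠ 0 := by
  have h : (besselPolynomial n).eval (x : ℂ) = ((∑ k ∈ Finset.range (n + 1),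
      ((n + k)! : ℝ) / (((n - k)! : ℝ) * (k ! : ℝ)) * (1 / 2 * x) ^ k : ℝ) : ℂ) := by
    simp [besselPolynomial, eval_finsetSum]
  rw [h, Complex.ofReal_ne_zero, Finset.sum_range_succ']
  have h0 : (0 : ℝ) < n ! := by exact_mod_cast n.factorial_pos
  have h1 : (0 : ℝ) ≤ ∑ k ∈ Finset.range n, ((n + (k + 1))! : ℝ) /
      (((n - (k + 1))! : ℝ) * ((k + 1)! : ℝ)) * (1 / 2 * x) ^ (k + 1) :=
    Finset.sum_nonneg fun k _ => by positivity
  have h2 : (0 : ℝ) < ((n + 0)! : ℝ) / (((n - 0)! : ℝ) * (0 ! : ℝ)) * (1 / 2 * x) ^ 0 := by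
    simp [h0.ne']
  exact (add_pos_of_nonneg_of_pos h1 h2).ne'

/-- At a zero of order `m ≥ 2`, necessarily nonzero, the equation would force `y''` to vanish to
order `m - 1` instead of `m - 2`. -/
theorem rootMultiplicity_besselPolynomial {n : ℕ} {z : ℂ} (hz : (besselPolynomial n).IsRoot z) :
    (besselPolynomial n).rootMultiplicity z = 1 := by
  set y := besselPolynomial n with hy
  have hy0 : y ≠ 0 := besselPolynomial_ne_zero n
  have hpos : 0 < y.rootMultiplicity z := (rootMultiplicity_pos hy0).2 hz
  by_contra hne
  have hz0 : z ≠ 0 := by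
    rintro rfl
    have := eval_zero_besselPolynomial n
    rw [IsRoot.def] at hz
    rw [← hy, hz] at this
    exact zero_ne_one this
  have h1 : (derivative y).rootMultiplicity z = y.rootMultiplicity z - 1 :=
    derivative_rootMultiplicity_of_root hz
  have hd0 : derivative y ≠ 0 := by
    intro h
    rw [h, rootMultiplicity_zero] at h1
    omega
  have hd : (derivative y).IsRoot z := (rootMultiplicity_pos hd0).1 (by omega)
  have h2 := derivative_rootMultiplicity_of_root hd
  have hdvd : (X - C z) ^ (y.rootMultiplicity z - 1) ∣ derivative (derivative y) := by
    have hcop : IsCoprime ((X - C z) ^ (y.rootMultiplicity z - 1)) (X ^ 2 : ℂ[X]) := by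
      have : IsCoprime (X - C z) (X - C 0 : ℂ[X]) := isCoprime_X_sub_C_of_isUnit_sub
        (by simpa using hz0)
      rw [C_0, sub_zero] at this
      exact this.pow
    refine hcop.dvd_of_dvd_mul_left ?_
    have e : X ^ 2 * derivative (derivative y) =
        C ((n : ℂ) * (n + 1)) * y - (2 * X + 2) * derivative y := by
      rw [← besselPolynomial_ode n]
      ring
    rw [e]
    refine dvd_sub (Dvd.dvd.mul_left ?_ _) (Dvd.dvd.mul_left ?_ _)
    · exact (pow_dvd_pow _ (Nat.sub_le _ _)).trans (pow_rootMultiplicity_dvd y z)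
    · rw [← h1]
      exact pow_rootMultiplicity_dvd _ _
  have hdd0 : derivative (derivative y) ≠ 0 := by
    intro h
    have h3 := derivative_eq_zero.1 h
    obtain ⟨c, hc⟩ := natDegree_eq_zero.1 h3
    rw [← hc, IsRoot.def, eval_C] at hd
    rw [← hc, hd, C_0] at hd0
    exact hd0 rfl
  have := (le_rootMultiplicity_iff hdd0).2 hdvd
  omega

/-! ### Modulus bound for the zeros -/

theorem one_half_le_re_div_sub {z w : ℂ} (hzw : z ≠ w) (h : ‖w‖ ≤ ‖z‖) :
    1 / 2 ≤ (z * (1 / (z - w))).re := by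
  have h0 : 0 < Complex.normSq (z - w) := Complex.normSq_pos.2 (sub_ne_zero.2 hzw)
  have h1 : Complex.normSq w ≤ Complex.normSq z := by
    rw [Complex.normSq_eq_norm_sq, Complex.normSq_eq_norm_sq]
    gcongr
  rw [one_div (z - w), Complex.mul_re, Complex.inv_re, Complex.inv_im]
  rw [show z.re * ((z - w).re / Complex.normSq (z - w)) -
    z.im * (-(z - w).im / Complex.normSq (z - w)) =
    (z.re * (z - w).re + z.im * (z - w).im) / Complex.normSq (z - w) by ring,
    div_le_div_iff₀ (by norm_num) h0]
  simp only [Complex.normSq_apply, Complex.sub_re, Complex.sub_im] at h1 ⊢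
  nlinarith

/-- With `y = (X - z) p`, the equation at `z` gives `∑ z/(z - w) = z p'(z)/p(z) = -1 - 1/z` over the
other `n - 1` zeros `w`. By maximality of `|z|`, each term has real part at least `1/2`. -/
theorem re_inv_le_of_isMaxRoot {n : ℕ} {z : ℂ} (hz : (besselPolynomial n).IsRoot z)
    (hmax : ∀ w, (besselPolynomial n).IsRoot w → ‖w‖ ≤ ‖z‖) : (z⁻¹).re ≤ -((n + 1) / 2) := by
  set y := besselPolynomial n with hy
  have hy0 : y ≠ 0 := besselPolynomial_ne_zero n
  have hz0 : z ≠ 0 := by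
    rintro rfl
    have := eval_zero_besselPolynomial n
    rw [IsRoot.def] at hz
    rw [← hy, hz] at this
    exact zero_ne_one this
  obtain ⟨p, hp⟩ := dvd_iff_isRoot.2 hz
  have hp0 : p ≠ 0 := by
    rintro rfl
    exact hy0 (by rw [hp, mul_zero])
  have hpz : p.eval z ≠ 0 := by
    intro h
    have h1 := rootMultiplicity_besselPolynomial hz
    rw [← hy, hp, rootMultiplicity_mul (by rwa [← hp]), rootMultiplicity_X_sub_C_self] at h1
    have := (rootMultiplicity_pos hp0).2 h
    omega
  have hdeg : p.natDegree + 1 = n := by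
    have h := natDegree_besselPolynomial n
    rw [← hy, hp, natDegree_mul (X_sub_C_ne_zero z) hp0, natDegree_X_sub_C] at h
    omega
  have hode : z ^ 2 * (2 * p.derivative.eval z) + (2 * z + 2) * p.eval z = 0 := by
    have h := congrArg (eval z) (besselPolynomial_ode n)
    rw [← hy, hp] at h
    simp at h
    linear_combination h
  have hsplit := IsAlgClosed.splits p
  have hsum := hsplit.eval_derivative_div_eval_of_ne_zero hpz
  have hcard : p.roots.card = p.natDegree := hsplit.natDegree_eq_card_roots.symm
  have hre : (p.natDegree : ℝ) * (1 / 2) ≤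
      (z * (p.roots.map fun w => 1 / (z - w)).sum).re := by
    rw [← Multiset.sum_map_mul_left, ← Complex.reLm_coe, map_multiset_sum, Multiset.map_map,
      ← hcard, ← nsmul_eq_mul]
    rw [← Multiset.card_map (Complex.reLm ∘ fun w => z * (1 / (z - w)))]
    refine Multiset.card_nsmul_le_sum fun x hx => ?_
    obtain ⟨w, hw, rfl⟩ := Multiset.mem_map.1 hx
    have hw' : p.eval w = 0 := isRoot_of_mem_roots hw
    refine one_half_le_re_div_sub ?_ (hmax w ?_)
    · rintro rfl
      exact hpz hw'
    · rw [hp, IsRoot.def, eval_mul, hw', mul_zero]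
  rw [← hsum, show z * (p.derivative.eval z / p.eval z) = -1 - z⁻¹ by
    field_simp
    linear_combination hode / 2] at hre
  have hdeg' : (p.natDegree : ℝ) + 1 = n := by exact_mod_cast hdeg
  simp only [Complex.sub_re, Complex.neg_re, Complex.one_re] at hre
  linarith

theorem norm_le_of_isRoot_besselPolynomial {n : ℕ} {z : ℂ}
    (hz : (besselPolynomial n).IsRoot z) : ‖z‖ * (n + 1) ≤ 2 := by
  have hne : (besselPolynomial n).roots.toFinset.Nonempty :=
    ⟨z, by simpa [besselPolynomial_ne_zero] using hz⟩
  obtain ⟨w, hw, hmax⟩ := Finset.exists_max_image _ (fun w : ℂ => ‖w‖) hne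
  have hw' : (besselPolynomial n).IsRoot w := by simpa [besselPolynomial_ne_zero] using hw
  have h := re_inv_le_of_isMaxRoot hw' fun v hv =>
    hmax v (by simpa [besselPolynomial_ne_zero] using hv)
  have h1 := (abs_le.1 (Complex.abs_re_le_norm w⁻¹)).1
  rw [norm_inv] at h1
  have h2 : ((n : ℝ) + 1) / 2 ≤ ‖w‖⁻¹ := by linarith
  have h3 : 0 < ‖w‖ := inv_pos.1 (lt_of_lt_of_le (by positivity) h2)
  have h4 : ‖w‖ * ((n + 1) / 2) ≤ 1 := by
    calc ‖w‖ * ((n + 1) / 2) ≤ ‖w‖ * ‖w‖⁻¹ := by gcongr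
      _ = 1 := mul_inv_cancel₀ h3.ne'
  have h5 : ‖z‖ ≤ ‖w‖ := hmax z (by simpa [besselPolynomial_ne_zero] using hz)
  nlinarith [n.cast_nonneg (α := ℝ)]

/-! ### The decaying solution on horizontal lines -/

theorem hasDerivAt_ray (v u : ℝ) : HasDerivAt (fun u : ℝ => (u + v * Complex.I : ℂ)) 1 u :=
  (Complex.ofRealCLM.hasDerivAt (x := u)).add_const _

theorem ray_ne_zero {v : ℝ} (hv : v ≠ 0) (u : ℝ) : (u + v * Complex.I : ℂ) ≠ 0 := by
  intro h
  have := congrArg Complex.im h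
  simp at this
  exact hv this

/-- The derivative keeps the same shape with a new polynomial, so a second application gives `f''`.
-/
theorem hasDerivAt_exp_neg_mul_eval_inv (p : ℂ[X]) {v : ℝ} (hv : v ≠ 0) (u : ℝ) :
    HasDerivAt (fun u : ℝ => Complex.exp (-(u + v * Complex.I)) * p.eval (u + v * Complex.I)⁻¹)
      (Complex.exp (-(u + v * Complex.I)) *
        (-(p + X ^ 2 * derivative p)).eval (u + v * Complex.I)⁻¹) u := by
  have h1 := hasDerivAt_ray v u
  have h2 := h1.inv (ray_ne_zero hv u)
  have h3 := (p.hasDerivAt (u + v * Complex.I : ℂ)⁻¹).comp u h2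
  refine (h1.neg.cexp.mul h3).congr_deriv ?_
  have := ray_ne_zero hv u
  simp
  field_simp
  ring

theorem tendsto_inv_ray (v : ℝ) :
    Filter.Tendsto (fun u : ℝ => (u + v * Complex.I : ℂ)⁻¹) Filter.atTop (nhds 0) := by
  refine Filter.tendsto_inv₀_cobounded.comp ?_
  rw [← tendsto_norm_atTop_iff_cobounded]
  refine Filter.tendsto_atTop_mono (fun u => ?_) Filter.tendsto_id
  have := Complex.re_le_norm (u + v * Complex.I : ℂ)
  simpa using this

theorem tendsto_eval_inv_ray (p : ℂ[X]) (v : ℝ) :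
    Filter.Tendsto (fun u : ℝ => p.eval (u + v * Complex.I : ℂ)⁻¹) Filter.atTop
      (nhds (p.eval 0)) :=
  (p.continuous.tendsto 0).comp (tendsto_inv_ray v)

theorem tendsto_exp_neg_ray (v : ℝ) :
    Filter.Tendsto (fun u : ℝ => Complex.exp (-(u + v * Complex.I))) Filter.atTop (nhds 0) := by
  rw [tendsto_zero_iff_norm_tendsto_zero]
  simp only [Complex.norm_exp]
  simpa using Real.tendsto_exp_neg_atTop_nhds_zero

theorem besselPolynomial_no_root_on_ray {n : ℕ} (hn : 1 ≤ n) {a v : ℝ} (hv : v ≠ 0)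
    (ha : -(1 / 4) ≤ a) : ¬ (besselPolynomial n).IsRoot (a + v * Complex.I : ℂ)⁻¹ := by
  intro hroot
  set y := besselPolynomial n with hy
  set N : ℝ := n * (n + 1) with hN
  have hn' : (1 : ℝ) ≤ n := by exact_mod_cast hn
  have hNpos : 0 < N := by positivity
  set f : ℝ → ℂ := fun u =>
    Complex.exp (-(u + v * Complex.I)) * y.eval (u + v * Complex.I)⁻¹ with hf
  set g : ℝ → ℂ := fun u => Complex.exp (-(u + v * Complex.I)) *
    (-(y + X ^ 2 * derivative y)).eval (u + v * Complex.I)⁻¹ with hg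
  set Q : ℝ → ℂ := fun u => 1 + N * ((u + v * Complex.I)⁻¹) ^ 2 with hQ
  set q : ℝ → ℝ := fun u => 2 * v ^ 2 * N / (u ^ 2 + v ^ 2) ^ 2 with hq
  have hpos : ∀ u : ℝ, 0 < u ^ 2 + v ^ 2 := fun u => by positivity
  have hinv : ∀ u : ℝ, ((u + v * Complex.I : ℂ)⁻¹) ^ 2 =
      ((u ^ 2 - v ^ 2) / (u ^ 2 + v ^ 2) ^ 2 : ℝ) +
        (-(2 * u * v) / (u ^ 2 + v ^ 2) ^ 2 : ℝ) * Complex.I := by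
    intro u
    have h0 := ray_ne_zero hv u
    have h1 : ((u : ℂ) ^ 2 + (v : ℂ) ^ 2) ≠ 0 := by exact_mod_cast (hpos u).ne'
    push_cast
    field_simp
    linear_combination (3 * (u : ℂ) ^ 2 * v ^ 2 + v ^ 4 + 2 * u * v ^ 3 * Complex.I) * Complex.I_sq
  have hQre : ∀ u, (Q u).re = 1 + N * ((u ^ 2 - v ^ 2) / (u ^ 2 + v ^ 2) ^ 2) := by
    intro u
    simp only [hQ, hinv]
    simp [-Complex.ofReal_div, -Complex.ofReal_pow, -Complex.ofReal_add]
  have hQim : ∀ u, (Q u).im = N * (-(2 * u * v) / (u ^ 2 + v ^ 2) ^ 2) := by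
    intro u
    simp only [hQ, hinv]
    simp [-Complex.ofReal_div, -Complex.ofReal_pow, -Complex.ofReal_add]
  have hfd : ∀ u, HasDerivAt f (g u) u := hasDerivAt_exp_neg_mul_eval_inv y hv
  have hgd : ∀ u, HasDerivAt g (Q u * f u) u := by
    intro u
    refine (hasDerivAt_exp_neg_mul_eval_inv _ hv u).congr_deriv ?_
    have h := congrArg (eval (u + v * Complex.I : ℂ)⁻¹) (besselPolynomial_ode n)
    simp [← hy, -inv_pow] at h
    simp [hQ, hf, hN, -inv_pow]
    linear_combination Complex.exp (-(v * Complex.I) + -u) *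
      (u + v * Complex.I : ℂ)⁻¹ ^ 2 * h
  have hlim : Filter.Tendsto (fun u => (g u * (starRingEnd ℂ) (f u)).im) Filter.atTop
      (nhds 0) := by
    have h1 := (tendsto_exp_neg_ray v).mul (tendsto_eval_inv_ray y v)
    have h2 := (tendsto_exp_neg_ray v).mul
      (tendsto_eval_inv_ray (-(y + X ^ 2 * derivative y)) v)
    have h3 := (Complex.continuous_im.tendsto _).comp
      (h2.mul ((Complex.continuous_conj.tendsto _).comp h1))
    simp only [zero_mul, Complex.zero_im] at h3
    exact h3
  have hzero : ∀ u, |a| < u → f u = 0 := fun u hu => by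
    refine eq_zero_of_decaying_of_eq_zero hfd hgd hlim (ε := v) (q := q) ?_ ?_ ?_ ha ?_ ?_ hu
    · intro u
      rw [hQim]
      simp only [hq]
      ring
    · intro u
      simp only [hq]
      positivity
    · intro u
      simp only [hq, neg_sq]
    · rw [IsRoot.def] at hroot
      simp only [hf, hroot, mul_zero]
    · intro ha0 u
      have hnorm := norm_le_of_isRoot_besselPolynomial hroot
      rw [norm_inv, inv_mul_le_iff₀ (norm_pos_iff.2 (ray_ne_zero hv a))] at hnorm
      have hsq : ‖(a + v * Complex.I : ℂ)‖ ^ 2 = a ^ 2 + v ^ 2 := by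
        rw [← Complex.normSq_eq_norm_sq, Complex.normSq_add_mul_I]
      -- The modulus bound gives `4(a² + v²) ≥ (n+1)²`, and `a² ≤ 1/16` costs only `1/4`, less than
      -- `(n+1)² - n(n+1)`.
      have hv2 : N ≤ 4 * v ^ 2 := by nlinarith
      have h1 : -4 ≤ N * ((u ^ 2 - v ^ 2) / (u ^ 2 + v ^ 2) ^ 2) := by
        have hp := hpos u
        rw [← mul_div_assoc, le_div_iff₀ (by positivity)]
        nlinarith [mul_nonneg (sub_nonneg.2 hv2) (sq_nonneg v), sq_nonneg u,
          mul_nonneg hNpos.le (sq_nonneg u), sq_nonneg (u ^ 2), sq_nonneg (u * v)]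
      rw [hQre]
      linarith
  have hev : ∀ u, |a| < u → y.eval (u + v * Complex.I : ℂ)⁻¹ = 0 := fun u hu =>
    (mul_eq_zero.1 (hzero u hu)).resolve_left (Complex.exp_ne_zero _)
  have h0 : y.eval 0 = 0 := tendsto_nhds_unique (tendsto_eval_inv_ray y v)
    (tendsto_const_nhds.congr' (Filter.eventually_of_mem (Filter.Ioi_mem_atTop |a|)
      fun u hu => (hev u hu).symm))
  rw [hy, eval_zero_besselPolynomial] at h0
  exact one_ne_zero h0

/-! ### Location of the zeros and of the nodes -/

theorem re_inv_lt_of_isRoot_besselPolynomial {n : ℕ} (hn : 1 ≤ n) {z : ℂ}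
    (hz : (besselPolynomial n).IsRoot z) : (z⁻¹).re < -(1 / 4) := by
  by_contra! hre
  have hn' : (1 : ℝ) ≤ n := by exact_mod_cast hn
  rw [← inv_inv z, ← Complex.re_add_im z⁻¹] at hz
  rcases eq_or_ne (z⁻¹).im 0 with him | him
  · rw [him, Complex.ofReal_zero, zero_mul, add_zero, ← Complex.ofReal_inv] at hz
    rcases le_or_gt 0 (z⁻¹).re with h | h
    · exact eval_besselPolynomial_ofReal_ne_zero n (inv_nonneg.2 h) hz
    · have h1 := norm_le_of_isRoot_besselPolynomial hz
      rw [Complex.norm_real, norm_inv, Real.norm_eq_abs, abs_of_neg h,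
        inv_mul_le_iff₀ (by linarith)] at h1
      linarith
  · exact besselPolynomial_no_root_on_ray hn him hre hz

theorem mainTheorem5 (n : ℕ) (hn : 1 ≤ n) (α : Fin n → ℂ) (hα : IsBesselZeros n α)
    (k : Fin n) : 1 < ‖nodeA (α k)‖ ∧ ‖nodeB (α k)‖ < 1 := by
  have hmem : α k ∈ (besselPolynomial n).roots := by
    rw [← hα]
    exact Multiset.mem_map_of_mem α (Finset.mem_univ k)
  have hre := re_inv_lt_of_isRoot_besselPolynomial hn (isRoot_of_mem_roots hmem)
  have h0 : 0 < Complex.normSq (α k) := by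
    refine Complex.normSq_pos.2 fun h => ?_
    norm_num [h] at hre
  rw [Complex.inv_re, div_lt_iff₀ h0] at hre
  constructor
  · rw [← one_lt_sq_iff₀ (norm_nonneg _), ← Complex.normSq_eq_norm_sq]
    simp [nodeA, Complex.normSq_apply] at hre h0 ⊢
    nlinarith
  · rw [← sq_lt_one_iff₀ (norm_nonneg _), ← Complex.normSq_eq_norm_sq]
    simp [nodeB, Complex.normSq_apply] at hre h0 ⊢
    nlinarith
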